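/- Let $N\ge 1$, $\lambda,\mu,\beta,\Delta>0$, $c\ge 0$, $p\ge 0$, and let $f:\mathbb R\to[0,\infty)$ be differentiable. On a probability space let $\Pi^a_i,\Pi^d_i,\Pi^r_i$ ($1\le i\le N$) be unit-rate Poisson processes (no independence between different processes is needed). For each integer $\eta\ge 1$ let $Q^\eta=(Q^\eta_1,\dots,Q^\eta_N)$ be a jointly measurable process on $[-\Delta,\infty)$ with values in $[0,\infty)^N$ such that, almost surely, the functions $s\mapsto f\big((Q^\eta_i(s-\Delta))^p-\tfrac1N\sum_{j}(Q^\eta_j(s-\Delta))^p\big)$ are locally integrable on $[0,\infty)$ and, for all $t\ge 0$ and all $i$, $$Q^{\eta}_i(t) = Q^{\eta}_i(0) + \frac1\eta\Pi^a_{i}\Big(\eta \int_0^t \lambda f\Big( (Q^{\eta}_i(s-\Delta))^p - \frac1N \sum_{j=1}^N (Q^{\eta}_j(s-\Delta))^p \Big)ds \Big) - \frac1\eta\Pi^d_{i} \Big(\eta \int_0^t \mu\, (Q^{\eta}_i(s) \wedge c)\, ds \Big) - \frac1\eta\Pi^r_{i}\Big(\eta \int_0^t \beta\, (Q^{\eta}_i(s)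 - c)^+ ds \Big).$$ Let $\varphi_1,\dots,\varphi_N$ be (deterministic) Lipschitz functions on $[-\Delta,0]$ such that, for every $i$ and every $s\in[-\Delta,0]$, $Q^\eta_i(s)\to\varphi_i(s)$ almost surely as $\eta\to\infty$ through the integers. Assume moreover that either $f$ is bounded, or the initial histories are almost surely eventually bounded, i.e. almost surely there is $K<\infty$ such that $Q^\eta_i(s)\le K$ for all sufficiently large $\eta$, all $i$ and all $s\in[-\Delta,0]$ (which holds in particular when the almost sure convergence of the histories is uniform in $s$). Then there is exactly one function $q=(q_1,\dots,q_N)$ on $[-\Delta,\infty)$ with $q_i=\varphi_i$ on $[-\Delta,0]$ and, for all $t\ge0$ (right derivative at $t=0$), $$\dot q_i(t) = \lambda f\Big( (q_i(t-\Delta))^p - \frac1N \sum_{j=1}^{N} (q_j(t-\Delta))^p \Big) - \mu\, ( q_i(t) \wedge c) - \beta\, (q_i(t) - c)^+ ,$$ and almost surely $Q^\eta(t)\to q(t)$ as $\eta\to\infty$, uniformly for $t$ in every compact subset of $[0,\infty)$. -/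

import Mathlib

open MeasureTheory ProbabilityTheory Filter Topology
open scoped NNReal

/-- A unit-rate Poisson process `X` under `P`: it starts at `0`, has independent increments,
the increment over `(s, t]` is Poisson with mean `t - s`, and almost every path is a
nondecreasing right-continuous counting path. (Paths being nondecreasing almost surely, the
natural-number subtraction in the increments is a genuine subtraction.) -/
structure IsUnitPoissonProcess {Ω : Type*} [MeasurableSpace Ω] (P : Measure Ω)
    (X : ℝ≥0 → Ω → ℕ) : Prop where
  measurable : ∀ t, Measurable (X t)
  zero : ∀ᵐ ω ∂P, X 0 ω = 0
  paths : ∀ᵐ ω ∂P, Monotone (fun t => X t ω) ∧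
    ∀ t, ContinuousWithinAt (fun s => X s ω) (Set.Ici t) t
  indep : HasIndepIncrements X P
  law : ∀ s t : ℝ≥0, s ≤ t → HasLaw (fun ω => X t ω - X s ω) (poissonMeasure (t - s)) P

/-- The mean-field input of queue `i` in state `x`: `x_i ^ p - (1/N) ∑_j x_j ^ p`. -/
noncomputable def meanFieldInput {N : ℕ} (p : ℝ) (x : Fin N → ℝ) (i : Fin N) : ℝ :=
  x i ^ p - (1 / (N : ℝ)) * ∑ j, x j ^ p

/-- `Q` (with `Q i t ω` the length of queue `i` at time `t ≥ -Δ`) is an `η`-scaled delayed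
mean-field queue length process driven by the processes `Na i` (arrivals), `Nd i` (services)
and `Nr i` (abandonments). It is a jointly measurable process with values in `[0, ∞)`, its
arrival rates are locally integrable (so that the time changes are meaningful; the service
and abandonment rates are then locally bounded), and it solves the scaled equation almost
surely for all `t ≥ 0`. -/
structure IsScaledQueue {Ω : Type*} [MeasurableSpace Ω] (P : Measure Ω) {N : ℕ}
    (lam mu beta c p Δ : ℝ) (f : ℝ → ℝ) (Na Nd Nr : Fin N → ℝ≥0 → Ω → ℕ)
    (η : ℕ) (Q : Fin N → ℝ → Ω → ℝ) : Prop where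
  measurable : ∀ i, Measurable (fun z : Set.Ici (-Δ) × Ω => Q i z.1 z.2)
  nonneg : ∀ᵐ ω ∂P, ∀ i, ∀ t, -Δ ≤ t → 0 ≤ Q i t ω
  integrable : ∀ᵐ ω ∂P, ∀ i, ∀ t : ℝ, 0 ≤ t →
    IntervalIntegrable (fun s => lam * f (meanFieldInput p (fun j => Q j (s - Δ) ω) i))
      volume 0 t
  equation : ∀ᵐ ω ∂P, ∀ i, ∀ t : ℝ, 0 ≤ t →
    Q i t ω = Q i 0 ω
      + (1 / (η : ℝ)) * (Na i (Real.toNNReal ((η : ℝ) *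
          ∫ s in (0 : ℝ)..t, lam * f (meanFieldInput p (fun j => Q j (s - Δ) ω) i))) ω : ℝ)
      - (1 / (η : ℝ)) * (Nd i (Real.toNNReal ((η : ℝ) *
          ∫ s in (0 : ℝ)..t, mu * min (Q i s ω) c)) ω : ℝ)
      - (1 / (η : ℝ)) * (Nr i (Real.toNNReal ((η : ℝ) *
          ∫ s in (0 : ℝ)..t, beta * max (Q i s ω - c) 0)) ω : ℝ)

/-- `q` solves the delay differential system on `[-Δ, ∞)` with initial history `φ`. The
derivative is two-sided for `t > 0` and the right derivative at `t = 0`. -/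
structure IsFluidSolution {N : ℕ} (lam mu beta c p Δ : ℝ) (f : ℝ → ℝ)
    (φ : Fin N → ℝ → ℝ) (q : Fin N → ℝ → ℝ) : Prop where
  history : ∀ i, ∀ s ∈ Set.Icc (-Δ) 0, q i s = φ i s
  deriv : ∀ i, ∀ t : ℝ, 0 ≤ t →
    HasDerivWithinAt (q i)
      (lam * f (meanFieldInput p (fun j => q j (t - Δ)) i)
        - mu * min (q i t) c - beta * max (q i t - c) 0)
      (Set.Ici 0) t

/-! ### The strong law of large numbers for unit-rate Poisson processes -/

/-! All the randomness sits in the law of large numbers: for almost every `ω`, each rescaled Poisson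
path is uniformly close to the identity on compact sets (`IsUnitPoissonProcess.ae_uniformLLN`). This
concerns one process at a time, so no joint law is needed, and the rest is deterministic for a fixed
`ω`.

The delay makes the system explicit. On each interval of length `Δ` the arrival rate depends only on
the path one delay earlier, so what remains is a scalar equation with known input and Lipschitz
drain. Solving it interval by interval gives existence and uniqueness of `q`.

Convergence follows the same steps. If the paths converge up to some time, dominated convergence
gives `L¹` convergence of the arrival rates up to `Δ` later (`tendsto_integral_rate_sub`), and
Grönwall turns this into uniform convergence there (`abs_sub_le_of_scaled_equation`). Only
continuity of the rate in the delayed state enters, so `x ^ p` may fail to be Lipschitz at `0`. The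
boundedness alternative supplies the dominating constant. On the history interval almost every time
suffices, and Fubini provides that. -/

theorem summable_pow_div_factorial_mul (r : ℝ) :
    Summable (fun n : ℕ => r ^ n / (n.factorial : ℝ) * n) := by
  rw [← summable_nat_add_iff 1]
  refine ((Real.summable_pow_div_factorial r).mul_left r).congr fun n => ?_
  have : (n.factorial : ℝ) ≠ 0 := by positivity
  rw [Nat.factorial_succ]
  push_cast
  field_simp
  ring

theorem integrable_natCast_poissonMeasure (r : ℝ≥0) :
    Integrable (fun n : ℕ => (n : ℝ)) (poissonMeasure r) := by
  rw [integrable_poissonMeasure_iff]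
  refine ((summable_pow_div_factorial_mul r).mul_left (Real.exp (-r))).congr fun n => ?_
  rw [Real.norm_natCast]
  ring

theorem integral_natCast_poissonMeasure (r : ℝ≥0) :
    ∫ n : ℕ, (n : ℝ) ∂(poissonMeasure r) = r := by
  refine (hasSum_integral_poissonMeasure (integrable_natCast_poissonMeasure r)).unique
    ((hasSum_nat_add_iff' 1).1 ?_)
  -- After an index shift, the series for the mean is `r` times the total mass.
  have h := (hasSum_one_poissonMeasure r).mul_left (r : ℝ)
  simp only [Finset.range_one, Finset.sum_singleton, Nat.cast_zero, smul_zero, sub_zero, mul_one]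
    at h ⊢
  refine (congrArg (HasSum · (r : ℝ)) (funext fun n => ?_)).mp h
  have : (n.factorial : ℝ) ≠ 0 := by positivity
  rw [Nat.factorial_succ, smul_eq_mul]
  push_cast
  field_simp
  ring

/-- At integer times the process is a sum of i.i.d. unit increments of mean `1`, so the strong law
applies. -/
theorem IsUnitPoissonProcess.ae_tendsto_div {Ω : Type*} [MeasurableSpace Ω] {P : Measure Ω}
    {X : ℝ≥0 → Ω → ℕ} (hX : IsUnitPoissonProcess P X) :
    ∀ᵐ ω ∂P, Tendsto (fun n : ℕ => (X n ω : ℝ) / n) atTop (𝓝 1) := by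
  set Y : ℕ → Ω → ℕ := fun k ω => X ((k + 1 : ℕ) : ℝ≥0) ω - X (k : ℝ≥0) ω with hY
  have hlaw : ∀ k, HasLaw (Y k) (poissonMeasure 1) P := by
    intro k
    have h := hX.law k ((k + 1 : ℕ) : ℝ≥0) (by simp)
    have h1 : ((k + 1 : ℕ) : ℝ≥0) - (k : ℝ≥0) = 1 := by
      push_cast; exact add_tsub_cancel_left _ _
    rwa [h1] at h
  have hind : iIndepFun Y P := hX.indep.nat (t := fun k : ℕ => (k : ℝ≥0)) Nat.mono_cast
  have hcast : Measurable (fun n : ℕ => (n : ℝ)) := measurable_from_top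
  have hint : Integrable (fun ω => (Y 0 ω : ℝ)) P := by
    have h := integrable_natCast_poissonMeasure 1
    rw [← (hlaw 0).map_eq] at h
    exact h.comp_aemeasurable (hlaw 0).aemeasurable
  have hmean : ∫ ω, (Y 0 ω : ℝ) ∂P = 1 := by
    have h := (hlaw 0).integral_comp (f := fun n : ℕ => (n : ℝ)) (by fun_prop)
    rw [integral_natCast_poissonMeasure] at h
    simpa [Function.comp_def] using h
  have hslln := strong_law_ae_real (μ := P) (fun k ω => (Y k ω : ℝ)) hint
    (fun i j hij => (hind.indepFun hij).comp hcast hcast)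
    (fun i => (IdentDistrib.mk (hlaw i).aemeasurable (hlaw 0).aemeasurable
      ((hlaw i).map_eq.trans (hlaw 0).map_eq.symm)).comp hcast)
  rw [hmean] at hslln
  filter_upwards [hslln, hX.zero, hX.paths] with ω hω h0 hp
  refine hω.congr fun n => ?_
  congr 1
  have hk : ∀ k : ℕ, (Y k ω : ℝ) = X ((k + 1 : ℕ) : ℝ≥0) ω - X (k : ℝ≥0) ω := fun k =>
    Nat.cast_sub (hp.1 (by simp))
  simp_rw [hk]
  rw [Finset.sum_range_sub (fun k : ℕ => (X (k : ℝ≥0) ω : ℝ))]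
  simp [h0]

/-- The rescaled path `u ↦ x (η u) / η` converges to the identity, uniformly on compact sets. -/
def UniformLLN (x : ℝ≥0 → ℕ) : Prop :=
  ∀ M ε : ℝ, 0 < ε → ∀ᶠ η : ℕ in atTop, ∀ u : ℝ, 0 ≤ u → u ≤ M →
    |(1 / (η : ℝ)) * (x (Real.toNNReal ((η : ℝ) * u)) : ℝ) - u| ≤ ε

/-- Monotonicity sandwiches `x t` between its values at `⌊t⌋₊` and `⌊t⌋₊ + 1`. The constant `C`
disappears under rescaling. -/
theorem exists_abs_sub_le_of_tendsto_div {x : ℝ≥0 → ℕ} (hmono : Monotone x)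
    (h : Tendsto (fun n : ℕ => (x n : ℝ) / n) atTop (𝓝 1)) {δ : ℝ} (hδ : 0 < δ) :
    ∃ C : ℝ, ∀ t : ℝ≥0, |(x t : ℝ) - t| ≤ δ * t + C := by
  obtain ⟨K, hK⟩ := (Metric.tendsto_atTop.1 h) δ hδ
  have hK' : ∀ k : ℕ, K ≤ k → |(x k : ℝ) - k| ≤ δ * k + x 0 := by
    intro k hk
    rcases Nat.eq_zero_or_pos k with rfl | hk0
    · simp
    have hkpos : (0 : ℝ) < k := by exact_mod_cast hk0
    have h1 := (hK k hk).le
    rw [Real.dist_eq, div_sub_one hkpos.ne', abs_div, abs_of_pos hkpos, div_le_iff₀ hkpos] at h1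
    have : (0 : ℝ) ≤ x 0 := Nat.cast_nonneg _
    linarith
  -- `x K + K` handles `t ≤ K`, `x 0` the integer `0`, and `1 + δ` the rounding up to `⌊t⌋₊ + 1`.
  refine ⟨x K + K + x 0 + 1 + δ, fun t => ?_⟩
  have hx0 : (0 : ℝ) ≤ x 0 := Nat.cast_nonneg _
  have hxK : (0 : ℝ) ≤ x K := Nat.cast_nonneg _
  have hK0 : (0 : ℝ) ≤ K := Nat.cast_nonneg _
  have ht0 : (0 : ℝ) ≤ t := t.2
  have hxt : (0 : ℝ) ≤ x t := Nat.cast_nonneg _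
  have hδt : 0 ≤ δ * t := by positivity
  rcases le_total t (K : ℝ≥0) with htK | htK
  · have h1 : (x t : ℝ) ≤ x K := by exact_mod_cast hmono htK
    have h2 : (t : ℝ) ≤ K := by exact_mod_cast htK
    rw [abs_le]
    constructor <;> linarith
  · have hfl : K ≤ ⌊t⌋₊ := Nat.le_floor htK
    have hle : ((⌊t⌋₊ : ℕ) : ℝ≥0) ≤ t := Nat.floor_le t.2
    have hlt : t ≤ ((⌊t⌋₊ + 1 : ℕ) : ℝ≥0) := by
      push_cast; exact (Nat.lt_floor_add_one t).le
    have h1 := hK' _ hfl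
    have h2 := hK' (⌊t⌋₊ + 1) (by omega)
    have h3 : (x ((⌊t⌋₊ : ℕ) : ℝ≥0) : ℝ) ≤ x t := by exact_mod_cast hmono hle
    have h4 : (x t : ℝ) ≤ x ((⌊t⌋₊ + 1 : ℕ) : ℝ≥0) := by exact_mod_cast hmono hlt
    have h5 : ((⌊t⌋₊ : ℕ) : ℝ) ≤ t := by exact_mod_cast hle
    have h6 : (t : ℝ) ≤ ((⌊t⌋₊ + 1 : ℕ) : ℝ) := by exact_mod_cast hlt
    rw [abs_le] at h1 h2 ⊢
    push_cast at h1 h2 h3 h4 h5 h6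
    have h7 : δ * ((⌊t⌋₊ : ℕ) : ℝ) ≤ δ * t := by gcongr
    constructor <;> nlinarith

theorem UniformLLN.of_tendsto_div {x : ℝ≥0 → ℕ} (hmono : Monotone x)
    (h : Tendsto (fun n : ℕ => (x n : ℝ) / n) atTop (𝓝 1)) : UniformLLN x := by
  intro M ε hε
  have hM : 0 < |M| + 1 := by positivity
  obtain ⟨C, hC⟩ := exists_abs_sub_le_of_tendsto_div hmono h (δ := ε / 2 / (|M| + 1)) (by positivity)
  have hlim : Tendsto (fun η : ℕ => C / (η : ℝ)) atTop (𝓝 0) :=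
    tendsto_const_div_atTop_nhds_zero_nat C
  filter_upwards [hlim.eventually (gt_mem_nhds (half_pos hε)), eventually_gt_atTop 0]
    with η hη hpos u hu0 huM
  have hη0 : (0 : ℝ) < η := by exact_mod_cast hpos
  have h1 := hC (Real.toNNReal ((η : ℝ) * u))
  rw [Real.coe_toNNReal _ (by positivity)] at h1
  have h2 : (1 / (η : ℝ)) * (x (Real.toNNReal ((η : ℝ) * u)) : ℝ) - u
      = ((x (Real.toNNReal ((η : ℝ) * u)) : ℝ) - η * u) / η := by
    field_simp
  rw [h2, abs_div, abs_of_pos hη0]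
  calc _ ≤ (ε / 2 / (|M| + 1) * (η * u) + C) / η := by gcongr
    _ = ε / 2 / (|M| + 1) * u + C / η := by field_simp
    _ ≤ ε / 2 / (|M| + 1) * (|M| + 1) + C / η := by
        gcongr
        linarith [le_abs_self M]
    _ = ε / 2 + C / η := by field_simp
    _ ≤ ε := by linarith

theorem IsUnitPoissonProcess.ae_uniformLLN {Ω : Type*} [MeasurableSpace Ω] {P : Measure Ω}
    {X : ℝ≥0 → Ω → ℕ} (hX : IsUnitPoissonProcess P X) :
    ∀ᵐ ω ∂P, UniformLLN (fun t => X t ω) := by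
  filter_upwards [hX.ae_tendsto_div, hX.paths] with ω h hp
  exact UniformLLN.of_tendsto_div hp.1 h

/-! ### Integral inequalities and scalar equations -/

/-- An integral form of Grönwall's inequality that does not require continuity. -/
theorem le_two_mul_exp_of_le_add_integral {u : ℝ → ℝ} {T L δ B : ℝ} (hL : 0 < L) (hδ : 0 ≤ δ)
    (hu : ∀ t ∈ Set.Icc 0 T, IntervalIntegrable u volume 0 t)
    (hu0 : ∀ t ∈ Set.Icc 0 T, 0 ≤ u t) (hB : ∀ t ∈ Set.Icc 0 T, u t ≤ B)
    (h : ∀ t ∈ Set.Icc 0 T, u t ≤ δ + L * ∫ s in (0 : ℝ)..t, u s) :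
    ∀ t ∈ Set.Icc 0 T, u t ≤ 2 * δ * Real.exp (2 * L * T) := by
  intro t₀ ht₀
  -- Weighted supremum norm: with exponent `2 * L` the integral term contributes at most half the
  -- supremum `b`, so `b ≤ δ + b / 2`. The bound `B` only makes `b` finite.
  set S : Set ℝ := (fun t => Real.exp (-(2 * L * t)) * u t) '' Set.Icc 0 T with hS
  have hbdd : BddAbove S := by
    refine ⟨B, ?_⟩
    rintro _ ⟨t, ht, rfl⟩
    have h1 : Real.exp (-(2 * L * t)) ≤ 1 := by
      rw [Real.exp_le_one_iff]
      have := mul_nonneg hL.le ht.1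
      linarith
    calc Real.exp (-(2 * L * t)) * u t ≤ 1 * u t := by gcongr; exact hu0 t ht
      _ ≤ B := by rw [one_mul]; exact hB t ht
  set b := sSup S with hb
  have hle : ∀ t ∈ Set.Icc 0 T, Real.exp (-(2 * L * t)) * u t ≤ b := fun t ht =>
    le_csSup hbdd ⟨t, ht, rfl⟩
  have hle' : ∀ t ∈ Set.Icc 0 T, u t ≤ b * Real.exp (2 * L * t) := by
    intro t ht
    have h1 := hle t ht
    rw [Real.exp_neg, inv_mul_le_iff₀ (Real.exp_pos _)] at h1
    linarith
  have hb0 : 0 ≤ b := le_trans (mul_nonneg (Real.exp_pos _).le (hu0 t₀ ht₀)) (hle t₀ ht₀)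
  have hkey : ∀ t ∈ Set.Icc 0 T, Real.exp (-(2 * L * t)) * u t ≤ δ + b / 2 := by
    intro t ht
    have hderiv : ∀ x ∈ Set.uIcc 0 t, HasDerivAt (fun s => b * (Real.exp (2 * L * s) / (2 * L)))
        (b * Real.exp (2 * L * x)) x := by
      intro x _
      have h1 : HasDerivAt (fun s => 2 * L * s) (2 * L) x := by
        simpa using (hasDerivAt_id x).const_mul (2 * L)
      have h2 := (h1.exp.div_const (2 * L)).const_mul b
      refine h2.congr_deriv ?_
      field_simp
    have hcont : Continuous (fun s => b * Real.exp (2 * L * s)) := by fun_prop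
    have hint : ∫ s in (0 : ℝ)..t, u s ≤ ∫ s in (0 : ℝ)..t, b * Real.exp (2 * L * s) :=
      intervalIntegral.integral_mono_on ht.1 (hu t ht) (hcont.intervalIntegrable _ _)
        fun s hs => hle' s ⟨hs.1, hs.2.trans ht.2⟩
    rw [intervalIntegral.integral_eq_sub_of_hasDerivAt hderiv (hcont.intervalIntegrable _ _)] at hint
    have h2 : u t ≤ δ + L * (b * (Real.exp (2 * L * t) / (2 * L))) := by
      refine (h t ht).trans ?_
      have : 0 ≤ b * (Real.exp (2 * L * 0) / (2 * L)) := by positivity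
      gcongr
      linarith
    have h3 : L * (b * (Real.exp (2 * L * t) / (2 * L))) = b / 2 * Real.exp (2 * L * t) := by
      field_simp
    have h4 : 1 ≤ Real.exp (2 * L * t) := by
      rw [Real.one_le_exp_iff]
      have := mul_nonneg hL.le ht.1
      linarith
    rw [Real.exp_neg, inv_mul_le_iff₀ (Real.exp_pos _)]
    nlinarith
  have hb2 : b ≤ δ + b / 2 := by
    refine csSup_le ⟨_, ⟨t₀, ht₀, rfl⟩⟩ ?_
    rintro _ ⟨t, ht, rfl⟩
    exact hkey t ht
  have hb3 : b ≤ 2 * δ := by linarith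
  calc u t₀ ≤ b * Real.exp (2 * L * t₀) := hle' t₀ ht₀
    _ ≤ 2 * δ * Real.exp (2 * L * T) := by
        gcongr
        exact ht₀.2

theorem abs_max_min_le (R x : ℝ) (hR : 0 ≤ R) : |max (-R) (min R x)| ≤ |x| := by
  rcases max_cases (-R) (min R x) with h | h <;> rcases min_cases R x with h' | h' <;>
    rw [h.1] <;> simp only [abs_neg, abs_of_nonneg hR, h'.1] <;>
    rcases abs_cases x with h'' | h'' <;> linarith

/-- Picard–Lindelöf over the whole of `[0, T]` needs a bounded field, so the argument of `h` is
truncated at an a priori Grönwall bound `R`. As `|h (κ x)| ≤ K * |x|`, the truncated solution also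
obeys that bound and never meets the truncation. -/
theorem exists_scalar_solution {g h : ℝ → ℝ} {K : ℝ≥0} (hg : Continuous g) (hh : LipschitzWith K h)
    (h0 : h 0 = 0) {T : ℝ} (hT : 0 ≤ T) (x₀ : ℝ) :
    ∃ y : ℝ → ℝ, y 0 = x₀ ∧
      ∀ t ∈ Set.Icc 0 T, HasDerivWithinAt y (g t - h (y t)) (Set.Icc 0 T) t := by
  obtain ⟨M, hM⟩ := isCompact_Icc.exists_bound_of_continuousOn (s := Set.Icc 0 T) hg.continuousOn
  have hM0 : 0 ≤ M := (norm_nonneg _).trans (hM 0 ⟨le_rfl, hT⟩)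
  set R : ℝ := gronwallBound |x₀| K M T with hR
  have hmono : Monotone (gronwallBound |x₀| K M) := gronwallBound_mono (abs_nonneg _) hM0 K.2
  have hR0 : 0 ≤ R := by
    refine (abs_nonneg x₀).trans ?_
    rw [← gronwallBound_x0 |x₀| K M]
    exact hmono hT
  set κ : ℝ → ℝ := fun x => max (-R) (min R x) with hκ
  have hκlip : LipschitzWith 1 κ := (LipschitzWith.id.const_min R).const_max (-R)
  have hκR : ∀ x, |κ x| ≤ R := fun x =>
    abs_le.2 ⟨le_max_left _ _, max_le (by linarith) (min_le_left _ _)⟩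
  have hhb : ∀ x, |h x| ≤ K * |x| := fun x => by
    simpa [h0, Real.dist_eq] using hh.dist_le_mul x 0
  lift M to ℝ≥0 using hM0
  lift T to ℝ≥0 using hT
  obtain ⟨R', hR'⟩ : ∃ R' : ℝ≥0, (R' : ℝ) = R := ⟨⟨R, hR0⟩, rfl⟩
  -- The radius is the bound on the field times the length `T`, so the solution lives on all of `[0,
  -- T]`.
  have hPL : IsPicardLindelof (fun t x => g t - h (κ x)) (tmin := 0) (tmax := (T : ℝ))
      ⟨0, le_rfl, T.2⟩ x₀ ((M + K * R') * T) 0 (M + K * R') K := by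
    refine ⟨fun t _ => ?_, fun x _ => ?_, fun t ht x _ => ?_, ?_⟩
    · refine LipschitzWith.lipschitzOnWith ?_
      have := (LipschitzWith.const (g t)).sub (hh.comp hκlip)
      simpa using this
    · exact (hg.sub continuous_const).continuousOn
    · calc ‖g t - h (κ x)‖ ≤ ‖g t‖ + ‖h (κ x)‖ := norm_sub_le _ _
        _ ≤ M + K * R' := by
          gcongr
          · exact hM t ht
          · refine (hhb _).trans ?_
            gcongr
            exact (hκR x).trans_eq hR'.symm
        _ = ((M + K * R' : ℝ≥0) : ℝ) := by push_cast; rfl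
    · simp
  obtain ⟨y, hy0, hy⟩ := hPL.exists_eq_forall_mem_Icc_hasDerivWithinAt₀
  refine ⟨y, hy0, fun t ht => ?_⟩
  have hbound : ∀ t ∈ Set.Icc (0 : ℝ) T, |y t| ≤ R := by
    intro t ht
    have h1 := norm_le_gronwallBound_of_norm_deriv_right_le (f := y) (a := 0) (b := T)
      (δ := |x₀|) (K := K) (ε := M) (HasDerivWithinAt.continuousOn hy)
      (fun s hs => (hy s ⟨hs.1, hs.2.le⟩).mono_of_mem_nhdsWithin
        (Icc_mem_nhdsGE_of_mem hs)) (by simp only at hy0; rw [hy0]; rfl)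
      (fun s hs => by
        calc ‖g s - h (κ (y s))‖ ≤ ‖g s‖ + ‖h (κ (y s))‖ := norm_sub_le _ _
          _ ≤ M + K * ‖y s‖ := by
            gcongr
            · exact hM s ⟨hs.1, hs.2.le⟩
            · refine (hhb _).trans ?_
              gcongr
              exact abs_max_min_le _ _ hR0
          _ = K * ‖y s‖ + M := add_comm _ _) t ht
    rw [sub_zero] at h1
    exact h1.trans ((hmono ht.2).trans_eq hR.symm)
  have hκy : κ (y t) = y t := by
    have := abs_le.1 (hbound t ht)
    simp only [hκ]
    rw [min_eq_right this.2, max_eq_right this.1]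
  have := hy t ht
  rwa [hκy] at this

theorem scalar_solution_unique {g h : ℝ → ℝ} {K : ℝ≥0} (hh : LipschitzWith K h) {T : ℝ}
    {y z : ℝ → ℝ} (h0 : y 0 = z 0)
    (hy : ∀ t ∈ Set.Icc 0 T, HasDerivWithinAt y (g t - h (y t)) (Set.Icc 0 T) t)
    (hz : ∀ t ∈ Set.Icc 0 T, HasDerivWithinAt z (g t - h (z t)) (Set.Icc 0 T) t) :
    Set.EqOn y z (Set.Icc 0 T) := by
  refine ODE_solution_unique_of_mem_Icc_right (v := fun t x => g t - h x) (s := fun _ => Set.univ)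
    (K := K) (fun t _ => LipschitzWith.lipschitzOnWith ?_) (HasDerivWithinAt.continuousOn hy)
    (fun s hs => (hy s ⟨hs.1, hs.2.le⟩).mono_of_mem_nhdsWithin (Icc_mem_nhdsGE_of_mem hs))
    (fun _ _ => trivial) (HasDerivWithinAt.continuousOn hz)
    (fun s hs => (hz s ⟨hs.1, hs.2.le⟩).mono_of_mem_nhdsWithin (Icc_mem_nhdsGE_of_mem hs))
    (fun _ _ => trivial) h0
  simpa using (LipschitzWith.const (g t)).sub hh

/-! ### Delay differential systems -/

/-- `q` solves `q_i'(t) = G (q(t - Δ)) i - h (q_i(t))` on `[0, T]` with initial history `φ`. -/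
structure IsDelaySolutionOn {N : ℕ} (G : (Fin N → ℝ) → Fin N → ℝ) (h : ℝ → ℝ) (Δ : ℝ)
    (φ : Fin N → ℝ → ℝ) (q : Fin N → ℝ → ℝ) (T : ℝ) : Prop where
  history : ∀ i, ∀ s ∈ Set.Icc (-Δ) 0, q i s = φ i s
  deriv : ∀ i, ∀ t ∈ Set.Icc 0 T,
    HasDerivWithinAt (q i) (G (fun j => q j (t - Δ)) i - h (q i t)) (Set.Icc 0 T) t

section Delay

variable {N : ℕ} {G : (Fin N → ℝ) → Fin N → ℝ} {h : ℝ → ℝ} {Δ : ℝ} {φ : Fin N → ℝ → ℝ}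
  {K : ℝ≥0}

theorem IsDelaySolutionOn.mono {q : Fin N → ℝ → ℝ} {T T' : ℝ}
    (hq : IsDelaySolutionOn G h Δ φ q T) (hT : T' ≤ T) : IsDelaySolutionOn G h Δ φ q T' where
  history := hq.history
  deriv i t ht := (hq.deriv i t ⟨ht.1, ht.2.trans hT⟩).mono (Set.Icc_subset_Icc_right hT)

/-- Agreement up to `n * Δ` equalizes the delayed inputs up to `(n + 1) * Δ`, where both solve the
same scalar equation. -/
theorem IsDelaySolutionOn.eqOn (hΔ : 0 < Δ) (hh : LipschitzWith K h) {q q' : Fin N → ℝ → ℝ} {T : ℝ}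
    (hq : IsDelaySolutionOn G h Δ φ q T) (hq' : IsDelaySolutionOn G h Δ φ q' T) (i : Fin N) :
    Set.EqOn (q i) (q' i) (Set.Icc (-Δ) T) := by
  have key : ∀ n : ℕ, ∀ i, Set.EqOn (q i) (q' i) (Set.Icc (-Δ) (min T (n * Δ))) := by
    intro n
    induction n with
    | zero =>
      intro i t ht
      have ht0 : t ∈ Set.Icc (-Δ) 0 := ⟨ht.1, by simpa using ht.2.trans (min_le_right _ _)⟩
      rw [hq.history i t ht0, hq'.history i t ht0]
    | succ n ih =>
      intro i t ht
      rcases le_total t 0 with ht0 | ht0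
      · rw [hq.history i t ⟨ht.1, ht0⟩, hq'.history i t ⟨ht.1, ht0⟩]
      · have hz : (0 : ℝ) ∈ Set.Icc (-Δ) 0 := ⟨by linarith, le_rfl⟩
        refine scalar_solution_unique hh (T := min T ((n + 1 : ℕ) * Δ))
          (by rw [hq.history i 0 hz, hq'.history i 0 hz])
          ((hq.mono (min_le_left _ _)).deriv i) (fun s hs => ?_) ⟨ht0, ht.2⟩
        have hd := (hq'.mono (min_le_left T ((n + 1 : ℕ) * Δ))).deriv i s hs
        have heq : (fun j => q j (s - Δ)) = fun j => q' j (s - Δ) := by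
          funext j
          refine ih j ⟨by linarith [hs.1], le_min ?_ ?_⟩
          · linarith [hs.2.trans (min_le_left _ _)]
          · have := hs.2.trans (min_le_right _ _)
            push_cast at this
            linarith
        rwa [← heq] at hd
  obtain ⟨n, hn⟩ := exists_nat_ge (T / Δ)
  have := key n i
  rwa [min_eq_left ((div_le_iff₀ hΔ).1 hn)] at this

/-- Method of steps. The horizon starts at `-Δ`, where the equation is vacuous and any continuous
extension of `φ` serves. Continuity on all of `ℝ` is carried along because the scalar lemma wants a
globally continuous input. -/
theorem exists_isDelaySolutionOn (hG : Continuous G) (hh : LipschitzWith K h) (h0 : h 0 = 0)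
    (hΔ : 0 < Δ) (hφ : ∀ i, ContinuousOn (φ i) (Set.Icc (-Δ) 0)) (n : ℕ) :
    ∃ q : Fin N → ℝ → ℝ, (∀ i, Continuous (q i)) ∧ IsDelaySolutionOn G h Δ φ q (n * Δ - Δ) := by
  have hΔ' : -Δ ≤ 0 := by linarith
  induction n with
  | zero =>
    refine ⟨fun i => Set.IccExtend hΔ' ((Set.Icc (-Δ) 0).domRestrict (φ i)),
      fun i => (hφ i).domRestrict.Icc_extend', fun i s hs => ?_, fun i t ht => ?_⟩
    · rw [Set.IccExtend_of_mem _ _ hs]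
      rfl
    · have := ht.1.trans ht.2
      norm_num at this
      linarith
  | succ n ih =>
    obtain ⟨q, hqc, hq⟩ := ih
    set T : ℝ := n * Δ - Δ with hT
    have hT' : ((n + 1 : ℕ) : ℝ) * Δ - Δ = T + Δ := by push_cast; ring
    have hT0 : 0 ≤ T + Δ := by rw [hT]; simp only [sub_add_cancel]; positivity
    rw [hT']
    have hg : ∀ i, Continuous (fun t => G (fun j => q j (t - Δ)) i) := fun i =>
      (continuous_apply i).comp
        (hG.comp (continuous_pi fun j => (hqc j).comp (continuous_id.sub continuous_const)))
    -- Solving afresh from time `0`, rather than from `T`, avoids gluing derivatives at `T`;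
    -- uniqueness identifies `y` with `q` on `[0, T]`.
    choose y hy0 hy using fun i => exists_scalar_solution (hg i) hh h0 hT0 (q i 0)
    have hyq : ∀ i, Set.EqOn (y i) (q i) (Set.Icc 0 T) := fun i =>
      scalar_solution_unique hh (hy0 i)
        (fun t ht => (hy i t ⟨ht.1, by linarith [ht.2]⟩).mono
          (Set.Icc_subset_Icc_right (by linarith))) (hq.deriv i)
    -- The clamp keeps `r` continuous on `ℝ`, since `y` is controlled only on `[0, T + Δ]`.
    set r : Fin N → ℝ → ℝ := fun i t => if t ≤ 0 then q i t else y i (max 0 (min t (T + Δ))) with hr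
    have hry : ∀ i, ∀ t ∈ Set.Icc 0 (T + Δ), r i t = y i t := by
      intro i t ht
      simp only [hr]
      split_ifs with h1
      · rw [le_antisymm h1 ht.1, hy0]
      · rw [min_eq_left ht.2, max_eq_right ht.1]
    have hrq : ∀ i, ∀ t, t ≤ T → r i t = q i t := by
      intro i t ht
      rcases le_total t 0 with ht0 | ht0
      · simp only [hr, if_pos ht0]
      · rw [hry i t ⟨ht0, by linarith⟩, hyq i ⟨ht0, ht⟩]
    refine ⟨r, fun i => ?_, fun i s hs => ?_, fun i t ht => ?_⟩
    · refine Continuous.if_le (hqc i) ?_ continuous_id continuous_const ?_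
      · refine (HasDerivWithinAt.continuousOn (hy i)).comp_continuous (by fun_prop) fun t => ?_
        exact ⟨le_max_left _ _, max_le hT0 (min_le_right _ _)⟩
      · intro t ht
        rw [ht, min_eq_left hT0, max_self, hy0]
    · simp only [hr, if_pos hs.2]
      exact hq.history i s hs
    · have heq : (fun j => r j (t - Δ)) = fun j => q j (t - Δ) := by
        funext j
        exact hrq j _ (by linarith [ht.2])
      rw [heq, hry i t ht]
      exact (hy i t ht).congr (hry i) (hry i t ht)

theorem exists_forall_isDelaySolutionOn (hG : Continuous G) (hh : LipschitzWith K h)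
    (h0 : h 0 = 0) (hΔ : 0 < Δ) (hφ : ∀ i, ContinuousOn (φ i) (Set.Icc (-Δ) 0)) :
    ∃ q : Fin N → ℝ → ℝ, ∀ T, IsDelaySolutionOn G h Δ φ q T := by
  choose q _ hq using exists_isDelaySolutionOn (φ := φ) hG hh h0 hΔ hφ
  -- Chosen so that the horizon `m t * Δ - Δ` reaches `t`; uniqueness makes the value at `t`
  -- independent of the horizon.
  set m : ℝ → ℕ := fun t => ⌈t / Δ⌉₊ + 1 with hm
  have hmt : ∀ t, t ≤ m t * Δ - Δ := by
    intro t
    have := (div_le_iff₀ hΔ).1 (Nat.le_ceil (t / Δ))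
    simp only [hm]
    push_cast
    linarith
  have heq : ∀ n i, Set.EqOn (fun t => q (m t) i t) (q n i) (Set.Icc (-Δ) (n * Δ - Δ)) := by
    intro n i t ht
    exact ((hq (m t)).mono (hmt t)).eqOn hΔ hh ((hq n).mono ht.2) i ⟨ht.1, le_rfl⟩
  refine ⟨fun i t => q (m t) i t, fun T => ?_⟩
  have hsub : Set.Icc (-Δ) T ⊆ Set.Icc (-Δ) (m T * Δ - Δ) := Set.Icc_subset_Icc_right (hmt T)
  refine ⟨fun i s hs => (hq _).history i s hs, fun i t ht => ?_⟩
  have hsub0 : Set.Icc 0 T ⊆ Set.Icc (-Δ) T := Set.Icc_subset_Icc_left (by linarith)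
  have h1 : (fun j => q (m (t - Δ)) j (t - Δ)) = fun j => q (m T) j (t - Δ) := by
    funext j
    exact heq (m T) j (hsub ⟨by linarith [ht.1], by linarith [ht.2]⟩)
  have h2 := heq (m T) i (hsub (hsub0 ht))
  simp only at h2 ⊢
  rw [h1, h2]
  exact (((hq (m T)).mono (hmt T)).deriv i t ht).congr
    (fun s hs => heq (m T) i (hsub (hsub0 hs))) h2

theorem IsDelaySolutionOn.continuousOn {q : Fin N → ℝ → ℝ} {T : ℝ}
    (hq : IsDelaySolutionOn G h Δ φ q T) (hφ : ∀ i, ContinuousOn (φ i) (Set.Icc (-Δ) 0))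
    (i : Fin N) : ContinuousOn (q i) (Set.Icc (-Δ) T) := by
  have h1 : ContinuousOn (q i) (Set.Icc (-Δ) 0) := (hφ i).congr (hq.history i)
  have h2 : ContinuousOn (q i) (Set.Icc 0 T) := HasDerivWithinAt.continuousOn (hq.deriv i)
  refine (h1.union_of_isClosed h2 isClosed_Icc isClosed_Icc).mono fun t ht => ?_
  rcases le_total t 0 with h | h
  · exact Or.inl ⟨ht.1, h⟩
  · exact Or.inr ⟨h, ht.2⟩

end Delay

/-! ### The departure rate and the fluid equation as a delay system -/

/-- The total rate of departures from a queue of length `x`. -/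
noncomputable def drainRate (mu beta c x : ℝ) : ℝ := mu * min x c + beta * max (x - c) 0

theorem drainRate_zero {mu beta c : ℝ} (hc : 0 ≤ c) : drainRate mu beta c 0 = 0 := by
  simp [drainRate, hc]

theorem abs_drainRate_sub_le {mu beta : ℝ} (hmu : 0 ≤ mu) (hbeta : 0 ≤ beta) (c x y : ℝ) :
    |drainRate mu beta c x - drainRate mu beta c y| ≤ (mu + beta) * |x - y| := by
  have h1 : |min x c - min y c| ≤ |x - y| := by
    have := abs_inf_sub_inf_le_abs x y c
    simpa using this
  have h2 : |max (x - c) 0 - max (y - c) 0| ≤ |x - y| := by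
    have := abs_sup_sub_sup_le_abs (x - c) (y - c) 0
    simpa using this
  calc |drainRate mu beta c x - drainRate mu beta c y|
      = |mu * (min x c - min y c) + beta * (max (x - c) 0 - max (y - c) 0)| := by
        rw [drainRate, drainRate]; congr 1; ring
    _ ≤ |mu * (min x c - min y c)| + |beta * (max (x - c) 0 - max (y - c) 0)| := abs_add_le _ _
    _ = mu * |min x c - min y c| + beta * |max (x - c) 0 - max (y - c) 0| := by
        rw [abs_mul, abs_mul, abs_of_nonneg hmu, abs_of_nonneg hbeta]
    _ ≤ mu * |x - y| + beta * |x - y| := by gcongr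
    _ = (mu + beta) * |x - y| := by ring

theorem lipschitzWith_drainRate {mu beta : ℝ} (hmu : 0 ≤ mu) (hbeta : 0 ≤ beta) (c : ℝ) :
    LipschitzWith (Real.toNNReal (mu + beta)) (drainRate mu beta c) := by
  refine LipschitzWith.of_dist_le_mul fun x y => ?_
  rw [Real.coe_toNNReal _ (add_nonneg hmu hbeta), Real.dist_eq, Real.dist_eq]
  exact abs_drainRate_sub_le hmu hbeta c x y

theorem continuous_meanFieldInput {N : ℕ} {p : ℝ} (hp : 0 ≤ p) :
    Continuous (fun (x : Fin N → ℝ) (i : Fin N) => meanFieldInput p x i) := by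
  have h : ∀ i : Fin N, Continuous (fun x : Fin N → ℝ => x i ^ p) := fun i =>
    (continuous_apply i).rpow_const fun _ => Or.inr hp
  refine continuous_pi fun i => (h i).sub (continuous_const.mul (continuous_finsetSum _ ?_))
  exact fun j _ => h j

theorem isFluidSolution_iff {N : ℕ} {lam mu beta c p Δ : ℝ} {f : ℝ → ℝ}
    {φ q : Fin N → ℝ → ℝ} :
    IsFluidSolution lam mu beta c p Δ f φ q ↔
      ∀ T, IsDelaySolutionOn (fun x i => lam * f (meanFieldInput p x i)) (drainRate mu beta c)
        Δ φ q T := by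
  constructor
  · intro h T
    refine ⟨h.history, fun i t ht => ?_⟩
    rw [drainRate, ← sub_sub]
    exact (h.deriv i t ht.1).mono Set.Icc_subset_Ici_self
  · intro h
    refine ⟨(h 0).history, fun i t ht => ?_⟩
    -- The horizon `t + 1` makes `Icc 0 (t + 1)` a neighbourhood of `t` within `Ici 0`.
    have h1 := (h (t + 1)).deriv i t ⟨ht, by linarith⟩
    rw [drainRate, ← sub_sub] at h1
    refine h1.mono_of_mem_nhdsWithin ?_
    rw [← Set.Ici_inter_Iic]
    exact inter_mem self_mem_nhdsWithin (mem_nhdsWithin_of_mem_nhds (Iic_mem_nhds (by linarith)))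

/-! ### Convergence along a single path -/

theorem intervalIntegrable_of_abs_le {x : ℝ → ℝ} {T B : ℝ}
    (hx : AEStronglyMeasurable x (volume.restrict (Set.Icc 0 T)))
    (hB : ∀ s ∈ Set.Icc 0 T, |x s| ≤ B) {t : ℝ} (ht : t ∈ Set.Icc 0 T) :
    IntervalIntegrable x volume 0 t := by
  rw [intervalIntegrable_iff_integrableOn_Icc_of_le ht.1]
  refine IntegrableOn.mono_set (t := Set.Icc 0 T) ?_ (Set.Icc_subset_Icc_right ht.2)
  refine Integrable.of_bound hx B ?_
  exact (ae_restrict_iff' measurableSet_Icc).2 (Eventually.of_forall hB)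

theorem integral_nonneg_and_le {x : ℝ → ℝ} {T B : ℝ} (hB0 : 0 ≤ B)
    (hx : AEStronglyMeasurable x (volume.restrict (Set.Icc 0 T)))
    (h0 : ∀ s ∈ Set.Icc 0 T, 0 ≤ x s) (hB : ∀ s ∈ Set.Icc 0 T, x s ≤ B)
    {t : ℝ} (ht : t ∈ Set.Icc 0 T) :
    0 ≤ ∫ s in (0 : ℝ)..t, x s ∧ ∫ s in (0 : ℝ)..t, x s ≤ B * T := by
  have hxi := intervalIntegrable_of_abs_le hx
    (fun s hs => (abs_of_nonneg (h0 s hs)).trans_le (hB s hs)) ht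
  refine ⟨intervalIntegral.integral_nonneg ht.1 fun s hs => h0 s ⟨hs.1, hs.2.trans ht.2⟩, ?_⟩
  calc ∫ s in (0 : ℝ)..t, x s ≤ ∫ _ in (0 : ℝ)..t, B :=
        intervalIntegral.integral_mono_on ht.1 hxi (by simp)
          fun s hs => hB s ⟨hs.1, hs.2.trans ht.2⟩
    _ = B * t := by simp [mul_comm]
    _ ≤ B * T := by gcongr; exact ht.2

/-- A path driven by counting paths that are `δ`-close to the identity (after rescaling) stays
close to the solution of the limiting scalar equation. -/
theorem abs_sub_le_of_scaled_equation {mu beta c : ℝ} (hmu : 0 < mu) (hbeta : 0 < beta)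
    (hc : 0 ≤ c) {T M X δ : ℝ} (hT : 0 ≤ T) (hδ : 0 < δ) (hδ1 : δ ≤ 1) (hX : 0 ≤ X) {η : ℕ}
    {na nd nr : ℝ≥0 → ℕ} {x g y γ : ℝ → ℝ}
    (hna : ∀ u : ℝ, 0 ≤ u → u ≤ M → |(1 / (η : ℝ)) * (na (Real.toNNReal (η * u)) : ℝ) - u| ≤ δ)
    (hnd : ∀ u : ℝ, 0 ≤ u → u ≤ mu * c * T →
      |(1 / (η : ℝ)) * (nd (Real.toNNReal (η * u)) : ℝ) - u| ≤ δ)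
    (hnr : ∀ u : ℝ, 0 ≤ u → u ≤ beta * (X + M + 1) * T →
      |(1 / (η : ℝ)) * (nr (Real.toNNReal (η * u)) : ℝ) - u| ≤ δ)
    (hxm : AEStronglyMeasurable x (volume.restrict (Set.Icc 0 T)))
    (hx0 : ∀ t ∈ Set.Icc 0 T, 0 ≤ x t) (hxX : x 0 ≤ X)
    (hg : IntervalIntegrable g volume 0 T) (hg0 : ∀ t ∈ Set.Icc 0 T, 0 ≤ g t)
    (hgM : ∫ s in (0 : ℝ)..T, g s ≤ M)
    (heq : ∀ t ∈ Set.Icc 0 T, x t = x 0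
      + (1 / (η : ℝ)) * (na (Real.toNNReal (η * ∫ s in (0 : ℝ)..t, g s)) : ℝ)
      - (1 / (η : ℝ)) * (nd (Real.toNNReal (η * ∫ s in (0 : ℝ)..t, mu * min (x s) c)) : ℝ)
      - (1 / (η : ℝ)) * (nr (Real.toNNReal (η * ∫ s in (0 : ℝ)..t, beta * max (x s - c) 0)) : ℝ))
    (hy : ContinuousOn y (Set.Icc 0 T)) (hγ : IntervalIntegrable γ volume 0 T)
    (hyeq : ∀ t ∈ Set.Icc 0 T,
      y t = y 0 + ∫ s in (0 : ℝ)..t, (γ s - drainRate mu beta c (y s)))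
    (h0 : |x 0 - y 0| ≤ δ) (hgγ : ∫ s in (0 : ℝ)..T, |g s - γ s| ≤ δ) :
    ∀ t ∈ Set.Icc 0 T, |x t - y t| ≤ 2 * (5 * δ) * Real.exp (2 * (mu + beta) * T) := by
  have hsub : ∀ t ∈ Set.Icc 0 T, Set.uIcc 0 t ⊆ Set.uIcc 0 T := by
    intro t ht
    rw [Set.uIcc_of_le ht.1, Set.uIcc_of_le hT]
    exact Set.Icc_subset_Icc_right ht.2
  have hgi : ∀ t ∈ Set.Icc 0 T, 0 ≤ ∫ s in (0 : ℝ)..t, g s ∧ ∫ s in (0 : ℝ)..t, g s ≤ M := by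
    intro t ht
    refine ⟨intervalIntegral.integral_nonneg ht.1 fun s hs => hg0 s ⟨hs.1, hs.2.trans ht.2⟩, ?_⟩
    refine le_trans ?_ hgM
    refine intervalIntegral.integral_mono_interval le_rfl ht.1 ht.2 ?_ hg
    exact (ae_restrict_iff' measurableSet_Ioc).2
      (Eventually.of_forall fun s hs => hg0 s ⟨hs.1.le, hs.2⟩)
  -- A priori bound on `x`: departures only lower the path, and scaled arrivals are at most `M + δ ≤
  -- M + 1`.
  set B : ℝ := X + M + 1 with hB
  have hM0 : 0 ≤ M := (hgi 0 ⟨le_rfl, hT⟩).1.trans (hgi 0 ⟨le_rfl, hT⟩).2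
  have hB0 : 0 ≤ B := by linarith
  have hxB : ∀ t ∈ Set.Icc 0 T, x t ≤ B := by
    intro t ht
    have h1 := abs_le.1 (hna _ (hgi t ht).1 (hgi t ht).2)
    have h2 : 0 ≤ (1 / (η : ℝ)) *
      (nd (Real.toNNReal (η * ∫ s in (0 : ℝ)..t, mu * min (x s) c)) : ℝ) := by positivity
    have h3 : 0 ≤ (1 / (η : ℝ)) *
      (nr (Real.toNNReal (η * ∫ s in (0 : ℝ)..t, beta * max (x s - c) 0)) : ℝ) := by positivity
    have h4 := (hgi t ht).2
    rw [heq t ht]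
    linarith
  have hdm : AEStronglyMeasurable (fun s => mu * min (x s) c) (volume.restrict (Set.Icc 0 T)) :=
    (hxm.inf aestronglyMeasurable_const).const_mul mu
  have hrm : AEStronglyMeasurable (fun s => beta * max (x s - c) 0)
      (volume.restrict (Set.Icc 0 T)) :=
    ((hxm.sub aestronglyMeasurable_const).sup aestronglyMeasurable_const).const_mul beta
  have hd0 : ∀ s ∈ Set.Icc 0 T, 0 ≤ mu * min (x s) c := fun s hs =>
    mul_nonneg hmu.le (le_min (hx0 s hs) hc)
  have hr0 : ∀ s ∈ Set.Icc 0 T, 0 ≤ beta * max (x s - c) 0 := fun s hs =>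
    mul_nonneg hbeta.le (le_max_right _ _)
  have hdB : ∀ s ∈ Set.Icc 0 T, mu * min (x s) c ≤ mu * c := fun s hs =>
    mul_le_mul_of_nonneg_left (min_le_right _ _) hmu.le
  have hrB : ∀ s ∈ Set.Icc 0 T, beta * max (x s - c) 0 ≤ beta * B := fun s hs =>
    mul_le_mul_of_nonneg_left (max_le (by linarith [hxB s hs]) hB0) hbeta.le
  have hdi : ∀ t ∈ Set.Icc 0 T, IntervalIntegrable (fun s => mu * min (x s) c) volume 0 t :=
    fun t ht => intervalIntegrable_of_abs_le hdm
      (fun s hs => (abs_of_nonneg (hd0 s hs)).trans_le (hdB s hs)) ht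
  have hri : ∀ t ∈ Set.Icc 0 T, IntervalIntegrable (fun s => beta * max (x s - c) 0) volume 0 t :=
    fun t ht => intervalIntegrable_of_abs_le hrm
      (fun s hs => (abs_of_nonneg (hr0 s hs)).trans_le (hrB s hs)) ht
  obtain ⟨Y, hY⟩ := isCompact_Icc.exists_bound_of_continuousOn hy
  have hum : AEStronglyMeasurable (fun s => |x s - y s|) (volume.restrict (Set.Icc 0 T)) :=
    (hxm.sub (hy.aestronglyMeasurable measurableSet_Icc)).norm
  have huB : ∀ s ∈ Set.Icc 0 T, |x s - y s| ≤ B + Y := by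
    intro s hs
    refine (abs_sub _ _).trans (add_le_add ?_ (hY s hs))
    rw [abs_of_nonneg (hx0 s hs)]
    exact hxB s hs
  have hui : ∀ t ∈ Set.Icc 0 T, IntervalIntegrable (fun s => |x s - y s|) volume 0 t :=
    fun t ht => intervalIntegrable_of_abs_le hum
      (fun s hs => (abs_abs _).trans_le (huB s hs)) ht
  -- The `5 * δ` collects the initial error, three counting-path errors and the `L¹` error of the
  -- input.
  refine le_two_mul_exp_of_le_add_integral (u := fun t => |x t - y t|) (by positivity)
    (by positivity) hui (fun t _ => abs_nonneg _) huB fun t ht => ?_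
  have hgt : IntervalIntegrable g volume 0 t := hg.mono_set (hsub t ht)
  have hγt : IntervalIntegrable γ volume 0 t := hγ.mono_set (hsub t ht)
  have hyd : IntervalIntegrable (fun s => drainRate mu beta c (y s)) volume 0 t := by
    refine ContinuousOn.intervalIntegrable ?_
    rw [Set.uIcc_of_le ht.1]
    exact (lipschitzWith_drainRate hmu.le hbeta.le c).continuous.comp_continuousOn
      (hy.mono (Set.Icc_subset_Icc_right ht.2))
  have hxd : IntervalIntegrable (fun s => drainRate mu beta c (x s)) volume 0 t :=
    (hdi t ht).add (hri t ht)
  have ea := hna _ (hgi t ht).1 (hgi t ht).2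
  have hdI := integral_nonneg_and_le (by positivity) hdm hd0 hdB ht
  have hrI := integral_nonneg_and_le (by positivity) hrm hr0 hrB ht
  have ed := hnd _ hdI.1 hdI.2
  have er := hnr _ hrI.1 hrI.2
  have hdsum : ∫ s in (0 : ℝ)..t, drainRate mu beta c (x s)
      = (∫ s in (0 : ℝ)..t, mu * min (x s) c) + ∫ s in (0 : ℝ)..t, beta * max (x s - c) 0 :=
    intervalIntegral.integral_add (hdi t ht) (hri t ht)
  have hysplit := hyeq t ht
  rw [intervalIntegral.integral_sub hγt hyd] at hysplit
  have hG : |(∫ s in (0 : ℝ)..t, g s) - ∫ s in (0 : ℝ)..t, γ s| ≤ δ := by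
    rw [← intervalIntegral.integral_sub hgt hγt]
    refine (intervalIntegral.abs_integral_le_integral_abs ht.1).trans (le_trans ?_ hgγ)
    exact intervalIntegral.integral_mono_interval le_rfl ht.1 ht.2
      (Eventually.of_forall fun s => abs_nonneg _) (hg.sub hγ).abs
  have hD : |(∫ s in (0 : ℝ)..t, drainRate mu beta c (x s))
      - ∫ s in (0 : ℝ)..t, drainRate mu beta c (y s)|
      ≤ (mu + beta) * ∫ s in (0 : ℝ)..t, |x s - y s| := by
    rw [← intervalIntegral.integral_sub hxd hyd, ← intervalIntegral.integral_const_mul]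
    refine (intervalIntegral.abs_integral_le_integral_abs ht.1).trans ?_
    exact intervalIntegral.integral_mono_on ht.1 (hxd.sub hyd).abs ((hui t ht).const_mul _)
      fun s _ => abs_drainRate_sub_le hmu.le hbeta.le c _ _
  have hxt := heq t ht
  rw [abs_le] at ea ed er hG hD h0 ⊢
  constructor <;> linarith

section Paths

variable {N : ℕ} {mu beta c Δ : ℝ} {G : (Fin N → ℝ) → Fin N → ℝ} {φ q : Fin N → ℝ → ℝ}
  {Q : ℕ → Fin N → ℝ → ℝ}

/-- If the rate itself is not bounded, the paths eventually stay in a compact box, by `K` on the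
history and by closeness to `q` afterwards, and `G` is bounded there. -/
theorem exists_rate_bound (hG : Continuous G) {T : ℝ}
    (hQ0 : ∀ η : ℕ, 1 ≤ η → ∀ i, ∀ t, -Δ ≤ t → 0 ≤ Q η i t)
    (hq : ∀ i, ContinuousOn (q i) (Set.Icc (-Δ) T))
    (hbdd : (∃ K : ℝ, ∀ x i, G x i ≤ K) ∨
      ∃ K : ℝ, ∀ᶠ η : ℕ in atTop, ∀ i, ∀ s ∈ Set.Icc (-Δ) 0, Q η i s ≤ K)
    (hconv : ∀ᶠ η : ℕ in atTop, ∀ i, ∀ t ∈ Set.Icc 0 T, |Q η i t - q i t| ≤ 1) :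
    ∃ C : ℝ, ∀ᶠ η : ℕ in atTop, ∀ i, ∀ t ∈ Set.Icc (-Δ) T, G (fun j => Q η j t) i ≤ C := by
  rcases hbdd with ⟨K, hK⟩ | ⟨K, hK⟩
  · exact ⟨K, Eventually.of_forall fun η i t _ => hK _ i⟩
  · choose Y hY using fun i => isCompact_Icc.exists_bound_of_continuousOn (hq i)
    set R : Fin N → ℝ := fun i => max K (|Y i| + 1) with hR
    have hcpt : IsCompact (Set.Icc (0 : Fin N → ℝ) R) := isCompact_Icc
    obtain ⟨C, hC⟩ := hcpt.exists_bound_of_continuousOn hG.continuousOn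
    refine ⟨C, ?_⟩
    filter_upwards [hK, hconv, eventually_ge_atTop 1] with η h1 h2 h3 i t ht
    have hmem : (fun j => Q η j t) ∈ Set.Icc (0 : Fin N → ℝ) R := by
      refine ⟨fun j => hQ0 η h3 j t ht.1, fun j => ?_⟩
      rcases le_total t 0 with h | h
      · exact (h1 j t ⟨ht.1, h⟩).trans (le_max_left _ _)
      · refine le_trans ?_ (le_max_right _ _)
        have h4 := (abs_le.1 (h2 j t ⟨h, ht.2⟩)).2
        have h5 : q j t ≤ Y j := (le_abs_self _).trans (hY j t ht)
        linarith [le_abs_self (Y j)]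
    exact (le_abs_self _).trans ((norm_le_pi_norm (G fun j => Q η j t) i).trans (hC _ hmem))

theorem tendsto_integral_rate_sub (hG : Continuous G) (hG0 : ∀ x i, 0 ≤ G x i) {T : ℝ}
    (hT : 0 ≤ T + Δ) (hq : ∀ i, ContinuousOn (q i) (Set.Icc (-Δ) T))
    (hQ0 : ∀ η : ℕ, 1 ≤ η → ∀ i, ∀ t, -Δ ≤ t → 0 ≤ Q η i t)
    (hint : ∀ η : ℕ, 1 ≤ η → ∀ i, ∀ t : ℝ, 0 ≤ t →
      IntervalIntegrable (fun s => G (fun j => Q η j (s - Δ)) i) volume 0 t)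
    (hae : ∀ i, ∀ᵐ s ∂volume.restrict (Set.Icc (-Δ) 0),
      Tendsto (fun η => Q η i s) atTop (𝓝 (q i s)))
    (hbdd : (∃ K : ℝ, ∀ x i, G x i ≤ K) ∨
      ∃ K : ℝ, ∀ᶠ η : ℕ in atTop, ∀ i, ∀ s ∈ Set.Icc (-Δ) 0, Q η i s ≤ K)
    (hconv : ∀ ε : ℝ, 0 < ε → ∀ᶠ η : ℕ in atTop, ∀ i, ∀ t ∈ Set.Icc 0 T, |Q η i t - q i t| ≤ ε)
    (i : Fin N) :
    Tendsto (fun η : ℕ => ∫ s in (0 : ℝ)..(T + Δ),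
      |G (fun j => Q η j (s - Δ)) i - G (fun j => q j (s - Δ)) i|) atTop (𝓝 0) := by
  obtain ⟨C, hC⟩ := exists_rate_bound hG hQ0 hq hbdd (hconv 1 one_pos)
  have hγ : ContinuousOn (fun s => G (fun j => q j (s - Δ)) i) (Set.Icc 0 (T + Δ)) := by
    refine ((continuous_apply i).comp hG).comp_continuousOn (continuousOn_pi.2 fun j => ?_)
    exact (hq j).comp (by fun_prop) fun s hs => ⟨by linarith [hs.1], by linarith [hs.2]⟩
  obtain ⟨D, hD⟩ := isCompact_Icc.exists_bound_of_continuousOn hγ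
  have hpt : ∀ᵐ s : ℝ, s ∈ Set.Icc 0 (T + Δ) →
      ∀ j, Tendsto (fun η => Q η j (s - Δ)) atTop (𝓝 (q j (s - Δ))) := by
    have h1 : ∀ᵐ s : ℝ, ∀ j, s ∈ Set.Icc (-Δ) 0 → Tendsto (fun η => Q η j s) atTop (𝓝 (q j s)) :=
      ae_all_iff.2 fun j => (ae_restrict_iff' measurableSet_Icc).1 (hae j)
    -- Shifting time by `Δ` preserves null sets, so almost everywhere convergence of the history
    -- passes to the delayed argument.
    have h2 := (measurePreserving_sub_right volume Δ).quasiMeasurePreserving.ae h1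
    filter_upwards [h2] with s hs hsT j
    rcases le_total (s - Δ) 0 with h | h
    · exact hs j ⟨by linarith [hsT.1], h⟩
    · refine Metric.tendsto_nhds.2 fun ε hε => ?_
      filter_upwards [hconv (ε / 2) (half_pos hε)] with η hη
      rw [Real.dist_eq]
      exact (hη j (s - Δ) ⟨h, by linarith [hsT.2]⟩).trans_lt (half_lt_self hε)
  have hlim := intervalIntegral.tendsto_integral_filter_of_dominated_convergence
    (μ := volume) (a := 0) (b := T + Δ) (l := atTop) (f := fun _ => (0 : ℝ))
    (F := fun (η : ℕ) s => |G (fun j => Q η j (s - Δ)) i - G (fun j => q j (s - Δ)) i|)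
    (fun _ => C + D) ?_ ?_ (by simp) ?_
  · simpa using hlim
  · filter_upwards [eventually_ge_atTop 1] with η hη
    have hγi : IntervalIntegrable (fun s => G (fun j => q j (s - Δ)) i) volume 0 (T + Δ) := by
      refine ContinuousOn.intervalIntegrable ?_
      rwa [Set.uIcc_of_le hT]
    exact (intervalIntegrable_iff.1 ((hint η hη i _ hT).sub hγi).abs).aestronglyMeasurable
  · filter_upwards [hC] with η hη
    refine Eventually.of_forall fun s hs => ?_
    rw [Set.uIoc_of_le hT] at hs
    rw [Real.norm_eq_abs, abs_abs]
    refine (abs_sub _ _).trans (add_le_add ?_ (hD s ⟨hs.1.le, hs.2⟩))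
    rw [abs_of_nonneg (hG0 _ _)]
    exact hη i _ ⟨by linarith [hs.1], by linarith [hs.2]⟩
  · filter_upwards [hpt] with s hs hsT
    rw [Set.uIoc_of_le hT] at hsT
    have h1 := hs ⟨hsT.1.le, hsT.2⟩
    have h2 : Tendsto (fun η => G (fun j => Q η j (s - Δ)) i) atTop
        (𝓝 (G (fun j => q j (s - Δ)) i)) :=
      (((continuous_apply i).comp hG).tendsto _).comp (tendsto_pi_nhds.2 h1)
    simpa using (h2.sub_const (G (fun j => q j (s - Δ)) i)).abs

/-- Induction on delay intervals: closeness up to `T` controls the arrival rates up to `T + Δ`,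
hence the queues up to `T + Δ`. The first horizon is `-Δ`, so the base case is empty. -/
theorem eventually_abs_sub_le_of_scaled_equations (hmu : 0 < mu) (hbeta : 0 < beta) (hc : 0 ≤ c)
    (hΔ : 0 < Δ) (hG : Continuous G) (hG0 : ∀ x i, 0 ≤ G x i)
    (hφ : ∀ i, ContinuousOn (φ i) (Set.Icc (-Δ) 0))
    (hq : ∀ T, IsDelaySolutionOn G (drainRate mu beta c) Δ φ q T)
    {na nd nr : Fin N → ℝ≥0 → ℕ} (hna : ∀ i, UniformLLN (na i)) (hnd : ∀ i, UniformLLN (nd i))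
    (hnr : ∀ i, UniformLLN (nr i))
    (hmeas : ∀ η : ℕ, 1 ≤ η → ∀ i, Measurable (fun s => Q η i (max (-Δ) s)))
    (hQ0 : ∀ η : ℕ, 1 ≤ η → ∀ i, ∀ t, -Δ ≤ t → 0 ≤ Q η i t)
    (hint : ∀ η : ℕ, 1 ≤ η → ∀ i, ∀ t : ℝ, 0 ≤ t →
      IntervalIntegrable (fun s => G (fun j => Q η j (s - Δ)) i) volume 0 t)
    (heq : ∀ η : ℕ, 1 ≤ η → ∀ i, ∀ t : ℝ, 0 ≤ t → Q η i t = Q η i 0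
      + (1 / (η : ℝ)) * (na i (Real.toNNReal ((η : ℝ) *
          ∫ s in (0 : ℝ)..t, G (fun j => Q η j (s - Δ)) i)) : ℝ)
      - (1 / (η : ℝ)) * (nd i (Real.toNNReal ((η : ℝ) *
          ∫ s in (0 : ℝ)..t, mu * min (Q η i s) c)) : ℝ)
      - (1 / (η : ℝ)) * (nr i (Real.toNNReal ((η : ℝ) *
          ∫ s in (0 : ℝ)..t, beta * max (Q η i s - c) 0)) : ℝ))
    (hae : ∀ i, ∀ᵐ s ∂volume.restrict (Set.Icc (-Δ) 0),
      Tendsto (fun η => Q η i s) atTop (𝓝 (φ i s)))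
    (h0 : ∀ i, Tendsto (fun η => Q η i 0) atTop (𝓝 (φ i 0)))
    (hbdd : (∃ K : ℝ, ∀ x i, G x i ≤ K) ∨
      ∃ K : ℝ, ∀ᶠ η : ℕ in atTop, ∀ i, ∀ s ∈ Set.Icc (-Δ) 0, Q η i s ≤ K)
    (n : ℕ) : ∀ ε : ℝ, 0 < ε → ∀ᶠ η : ℕ in atTop, ∀ i, ∀ t ∈ Set.Icc 0 (n * Δ - Δ),
      |Q η i t - q i t| ≤ ε := by
  have hqc := fun T => (hq T).continuousOn hφ
  have hz : (0 : ℝ) ∈ Set.Icc (-Δ) 0 := ⟨by linarith, le_rfl⟩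
  induction n with
  | zero =>
    refine fun ε _ => Eventually.of_forall fun η i t ht => ?_
    have := ht.1.trans ht.2
    norm_num at this
    linarith
  | succ n ih =>
    intro ε hε
    set T : ℝ := n * Δ - Δ with hTdef
    have hT' : ((n + 1 : ℕ) : ℝ) * Δ - Δ = T + Δ := by push_cast; ring
    have hT0 : 0 ≤ T + Δ := by rw [hTdef]; simp only [sub_add_cancel]; positivity
    rw [hT']
    refine eventually_all.2 fun i => ?_
    have hae' : ∀ i, ∀ᵐ s ∂volume.restrict (Set.Icc (-Δ) 0),
        Tendsto (fun η => Q η i s) atTop (𝓝 (q i s)) := by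
      intro i
      filter_upwards [hae i, ae_restrict_mem measurableSet_Icc] with s hs hmem
      rwa [(hq 0).history i s hmem]
    have hlim := tendsto_integral_rate_sub hG hG0 hT0 (hqc T) hQ0 hint hae' hbdd ih i
    set γ : ℝ → ℝ := fun s => G (fun j => q j (s - Δ)) i with hγdef
    have hγ : ContinuousOn γ (Set.Icc 0 (T + Δ)) := by
      refine ((continuous_apply i).comp hG).comp_continuousOn (continuousOn_pi.2 fun j => ?_)
      exact (hqc T j).comp (by fun_prop) fun s hs => ⟨by linarith [hs.1], by linarith [hs.2]⟩
    have hγi : IntervalIntegrable γ volume 0 (T + Δ) := by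
      refine ContinuousOn.intervalIntegrable ?_
      rwa [Set.uIcc_of_le hT0]
    have hqc0 : ContinuousOn (q i) (Set.Icc 0 (T + Δ)) :=
      (hqc (T + Δ) i).mono (Set.Icc_subset_Icc_left (by linarith))
    have hyeq : ∀ t ∈ Set.Icc 0 (T + Δ),
        q i t = q i 0 + ∫ s in (0 : ℝ)..t, (γ s - drainRate mu beta c (q i s)) := by
      intro t ht
      have hcont : ContinuousOn (fun s => γ s - drainRate mu beta c (q i s)) (Set.Icc 0 t) :=
        (hγ.sub ((lipschitzWith_drainRate hmu.le hbeta.le c).continuous.comp_continuousOn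
          hqc0)).mono (Set.Icc_subset_Icc_right ht.2)
      rw [intervalIntegral.integral_eq_sub_of_hasDeriv_right_of_le ht.1
        (hqc0.mono (Set.Icc_subset_Icc_right ht.2)) (fun s hs => ?_)
        (ContinuousOn.intervalIntegrable (by rwa [Set.uIcc_of_le ht.1]))]
      · ring
      · exact (((hq t).deriv i s ⟨hs.1.le, hs.2.le⟩).mono_of_mem_nhdsWithin
          (Icc_mem_nhdsGE_of_mem ⟨hs.1.le, hs.2⟩)).mono Set.Ioi_subset_Ici_self
    set E := Real.exp (2 * (mu + beta) * (T + Δ)) with hE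
    have hE0 : 0 < E := Real.exp_pos _
    -- Makes the Grönwall bound `2 * (5 * δ) * E` at most `ε`. The cap `1` lets `M` and `X`, fixed
    -- before `η`, bound total arrivals and initial values for all large `η`.
    set δ : ℝ := min 1 (ε / (10 * E)) with hδdef
    have hδ : 0 < δ := lt_min one_pos (by positivity)
    set M : ℝ := (∫ s in (0 : ℝ)..(T + Δ), γ s) + 1 with hM
    set X : ℝ := |φ i 0| + 1 with hX
    filter_upwards [eventually_ge_atTop 1, hna i M δ hδ, hnd i (mu * c * (T + Δ)) δ hδ,
      hnr i (beta * (X + M + 1) * (T + Δ)) δ hδ, hlim.eventually (ge_mem_nhds hδ),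
      Metric.tendsto_nhds.1 (h0 i) δ hδ] with η hη h1 h2 h3 h4 h5 t ht
    rw [Real.dist_eq] at h5
    have hxX : Q η i 0 ≤ X := by
      have := (abs_lt.1 h5).2
      have h6 : δ ≤ 1 := min_le_left _ _
      have h7 := le_abs_self (φ i 0)
      linarith
    have hgi := hint η hη i _ hT0
    have hgM : ∫ s in (0 : ℝ)..(T + Δ), G (fun j => Q η j (s - Δ)) i ≤ M := by
      have h6 := intervalIntegral.abs_integral_le_integral_abs (μ := volume) hT0
        (f := fun s => G (fun j => Q η j (s - Δ)) i - γ s)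
      rw [intervalIntegral.integral_sub hgi hγi] at h6
      have h7 : δ ≤ 1 := min_le_left _ _
      have h8 := (abs_le.1 (h6.trans h4)).2
      linarith
    have hxm : AEStronglyMeasurable (Q η i) (volume.restrict (Set.Icc 0 (T + Δ))) := by
      refine (hmeas η hη i).aestronglyMeasurable.congr ?_
      filter_upwards [ae_restrict_mem measurableSet_Icc] with s hs
      rw [max_eq_right (by linarith [hs.1])]
    have hfin := abs_sub_le_of_scaled_equation hmu hbeta hc hT0 hδ (min_le_left _ _)
      (by positivity) h1 h2 h3 hxm (fun s hs => hQ0 η hη i s (by linarith [hs.1])) hxX hgi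
      (fun s _ => hG0 _ _) hgM (fun s hs => heq η hη i s hs.1) hqc0 hγi hyeq
      (by rw [(hq 0).history i 0 hz]; exact h5.le) h4 t ht
    refine hfin.trans ?_
    calc 2 * (5 * δ) * E ≤ 2 * (5 * (ε / (10 * E))) * E := by
          gcongr
          exact min_le_right _ _
      _ = ε := by field_simp; norm_num

end Paths

/-! ### Almost sure convergence of the histories -/

/-- Pointwise almost sure convergence of jointly measurable processes implies that almost every
path converges at almost every time. -/
theorem ae_ae_tendsto_of_forall_ae_tendsto {Ω : Type*} [MeasurableSpace Ω] {P : Measure Ω}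
    [SFinite P] {a b : ℝ} (hab : a ≤ b) {Y : ℕ → ℝ → Ω → ℝ} {ψ : ℝ → ℝ}
    (hψ : ContinuousOn ψ (Set.Icc a b))
    (hY : ∀ n : ℕ, 1 ≤ n → Measurable (fun z : ℝ × Ω => Y n (max a z.1) z.2))
    (hlim : ∀ s ∈ Set.Icc a b, ∀ᵐ ω ∂P, Tendsto (fun n => Y n s ω) atTop (𝓝 (ψ s))) :
    ∀ᵐ ω ∂P, ∀ᵐ s ∂volume.restrict (Set.Icc a b),
      Tendsto (fun n => Y n s ω) atTop (𝓝 (ψ s)) := by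
  set ψ' : ℝ → ℝ := Set.IccExtend hab ((Set.Icc a b).domRestrict ψ) with hψ'
  have hψ'c : Continuous ψ' := hψ.domRestrict.Icc_extend'
  have hψ'eq : ∀ s ∈ Set.Icc a b, ψ' s = ψ s := fun s hs => by
    rw [hψ', Set.IccExtend_of_mem _ _ hs]
    rfl
  -- The shift `n + 1` skips index `0`, about which nothing is assumed; subtracting `ψ'` gives a
  -- constant limit.
  have hms : MeasurableSet {z : ℝ × Ω |
      Tendsto (fun n : ℕ => Y (n + 1) (max a z.1) z.2 - ψ' z.1) atTop (𝓝 0)} :=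
    measurableSet_tendsto _ fun n =>
      (hY (n + 1) (by omega)).sub (hψ'c.measurable.comp measurable_fst)
  have key : ∀ s ∈ Set.Icc a b, ∀ ω,
      Tendsto (fun n : ℕ => Y (n + 1) (max a s) ω - ψ' s) atTop (𝓝 0) ↔
        Tendsto (fun n => Y n s ω) atTop (𝓝 (ψ s)) := by
    intro s hs ω
    rw [max_eq_right hs.1, hψ'eq s hs, tendsto_sub_nhds_zero_iff,
      tendsto_add_atTop_iff_nat (f := fun n => Y n s ω) 1]
  have h1 : ∀ᵐ s ∂volume.restrict (Set.Icc a b), ∀ᵐ ω ∂P,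
      Tendsto (fun n : ℕ => Y (n + 1) (max a s) ω - ψ' s) atTop (𝓝 0) := by
    filter_upwards [ae_restrict_mem measurableSet_Icc] with s hs
    filter_upwards [hlim s hs] with ω hω
    exact (key s hs ω).2 hω
  -- Fubini exchanges the two "almost every" quantifiers.
  filter_upwards [(Measure.ae_ae_comm hms).1 h1] with ω hω
  filter_upwards [hω, ae_restrict_mem measurableSet_Icc] with s hs hmem
  exact (key s hmem ω).1 hs

theorem theorem1 {Ω : Type*} [MeasurableSpace Ω] (P : Measure Ω) [IsProbabilityMeasure P]
    (N : ℕ) (lam mu beta c p Δ : ℝ)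
    (hlam : 0 < lam) (hmu : 0 < mu) (hbeta : 0 < beta) (hc : 0 ≤ c) (hp : 0 ≤ p) (hΔ : 0 < Δ)
    (f : ℝ → ℝ) (hf : Differentiable ℝ f) (hf0 : ∀ x, 0 ≤ f x)
    (Na Nd Nr : Fin N → ℝ≥0 → Ω → ℕ)
    (hNa : ∀ i, IsUnitPoissonProcess P (Na i))
    (hNd : ∀ i, IsUnitPoissonProcess P (Nd i))
    (hNr : ∀ i, IsUnitPoissonProcess P (Nr i))
    (Q : ℕ → Fin N → ℝ → Ω → ℝ)
    (hQ : ∀ η : ℕ, 1 ≤ η → IsScaledQueue P lam mu beta c p Δ f Na Nd Nr η (Q η))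
    (φ : Fin N → ℝ → ℝ)
    (hφ : ∀ i, ∃ L : ℝ≥0, LipschitzOnWith L (φ i) (Set.Icc (-Δ) 0))
    (hinit : ∀ i, ∀ s ∈ Set.Icc (-Δ) 0,
      ∀ᵐ ω ∂P, Tendsto (fun η : ℕ => Q η i s ω) atTop (𝓝 (φ i s)))
    (hbdd : (∃ K : ℝ, ∀ x, f x ≤ K) ∨
      ∀ᵐ ω ∂P, ∃ K : ℝ, ∀ᶠ η : ℕ in atTop, ∀ i, ∀ s ∈ Set.Icc (-Δ) 0, Q η i s ω ≤ K) :
    ∃ q : Fin N → ℝ → ℝ,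
      IsFluidSolution lam mu beta c p Δ f φ q ∧
      (∀ q' : Fin N → ℝ → ℝ, IsFluidSolution lam mu beta c p Δ f φ q' →
        ∀ i, Set.EqOn (q' i) (q i) (Set.Ici (-Δ))) ∧
      ∀ᵐ ω ∂P, ∀ S : Set ℝ, S ⊆ Set.Ici 0 → IsCompact S →
        TendstoUniformlyOn (fun (η : ℕ) (t : ℝ) (i : Fin N) => Q η i t ω)
          (fun (t : ℝ) (i : Fin N) => q i t) atTop S := by
  set G : (Fin N → ℝ) → Fin N → ℝ := fun x i => lam * f (meanFieldInput p x i) with hGdef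
  have hG : Continuous G := continuous_pi fun i => continuous_const.mul
    (hf.continuous.comp ((continuous_apply i).comp (continuous_meanFieldInput hp)))
  have hG0 : ∀ x i, 0 ≤ G x i := fun x i => mul_nonneg hlam.le (hf0 _)
  have hlip := lipschitzWith_drainRate hmu.le hbeta.le c
  have hφc : ∀ i, ContinuousOn (φ i) (Set.Icc (-Δ) 0) := fun i => by
    obtain ⟨L, hL⟩ := hφ i
    exact hL.continuousOn
  obtain ⟨q, hq⟩ := exists_forall_isDelaySolutionOn hG hlip (drainRate_zero hc) hΔ hφc
  refine ⟨q, isFluidSolution_iff.2 hq, fun q' hq' i t ht => ?_, ?_⟩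
  · exact (isFluidSolution_iff.1 hq' t).eqOn hΔ hlip (hq t) i ⟨ht, le_rfl⟩
  -- Measurability is given only on times `≥ -Δ`; clamping extends it to the whole line.
  have hmeas : ∀ η : ℕ, 1 ≤ η → ∀ i,
      Measurable (fun z : ℝ × Ω => Q η i (max (-Δ) z.1) z.2) := by
    intro η hη i
    have h : Measurable (fun z : ℝ × Ω =>
        ((⟨max (-Δ) z.1, Set.mem_Ici.2 (le_max_left _ _)⟩ : Set.Ici (-Δ)), z.2)) :=
      ((measurable_const.max measurable_fst).subtype_mk).prodMk measurable_snd
    exact ((hQ η hη).measurable i).comp h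
  have hhist : ∀ᵐ ω ∂P, ∀ i, ∀ᵐ s ∂volume.restrict (Set.Icc (-Δ) 0),
      Tendsto (fun η => Q η i s ω) atTop (𝓝 (φ i s)) := ae_all_iff.2 fun i =>
    ae_ae_tendsto_of_forall_ae_tendsto (Y := fun η => Q η i) (by linarith) (hφc i)
      (fun η hη => hmeas η hη i) (hinit i)
  have hzero : ∀ᵐ ω ∂P, ∀ i, Tendsto (fun η => Q η i 0 ω) atTop (𝓝 (φ i 0)) :=
    ae_all_iff.2 fun i => hinit i 0 ⟨by linarith, le_rfl⟩
  have hbdd' : ∀ᵐ ω ∂P, (∃ K : ℝ, ∀ x i, G x i ≤ K) ∨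
      ∃ K : ℝ, ∀ᶠ η : ℕ in atTop, ∀ i, ∀ s ∈ Set.Icc (-Δ) 0, Q η i s ω ≤ K := by
    rcases hbdd with ⟨K, hK⟩ | h
    · exact Eventually.of_forall fun _ =>
        Or.inl ⟨lam * K, fun x i => mul_le_mul_of_nonneg_left (hK _) hlam.le⟩
    · exact h.mono fun _ => Or.inr
  have hall : ∀ R : ℕ → Ω → Prop, (∀ η : ℕ, 1 ≤ η → ∀ᵐ ω ∂P, R η ω) →
      ∀ᵐ ω ∂P, ∀ η : ℕ, 1 ≤ η → R η ω := fun R h =>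
    ae_all_iff.2 fun η => eventually_imp_distrib_left.2 (h η)
  filter_upwards [hhist, hzero, hbdd', ae_all_iff.2 fun i => (hNa i).ae_uniformLLN,
    ae_all_iff.2 fun i => (hNd i).ae_uniformLLN, ae_all_iff.2 fun i => (hNr i).ae_uniformLLN,
    hall _ fun η hη => (hQ η hη).nonneg, hall _ fun η hη => (hQ η hη).integrable,
    hall _ fun η hη => (hQ η hη).equation]
    with ω w1 w2 w3 w4 w5 w6 w7 w8 w9 S hS0 hScpt
  have hconv := eventually_abs_sub_le_of_scaled_equations (Q := fun η i t => Q η i t ω) hmu hbeta hc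
    hΔ hG hG0 hφc hq w4 w5 w6 (fun η hη i => (hmeas η hη i).comp measurable_prodMk_right)
    w7 w8 w9 w1 w2 w3
  obtain ⟨T, hT⟩ := hScpt.bddAbove
  -- The extra `Δ` offsets the horizon `n * Δ - Δ`, which then covers `S`.
  obtain ⟨n, hn⟩ := exists_nat_ge ((T + Δ) / Δ)
  rw [div_le_iff₀ hΔ] at hn
  refine Metric.tendstoUniformlyOn_iff.2 fun ε hε => ?_
  filter_upwards [hconv n (ε / 2) (half_pos hε)] with η hη t ht
  refine lt_of_le_of_lt ((dist_pi_le_iff (half_pos hε).le).2 fun i => ?_) (half_lt_self hε)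
  rw [dist_comm, Real.dist_eq]
  exact hη i t ⟨hS0 ht, by linarith [hT ht]⟩
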